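/- For integers $n\ge 1$, $0\le k<d$ and $r\ge k+2$, let $f_{\mathrm{aff}}(n,d,k,r)$ denote the maximum size of a subset of $[n]^d=\{1,\dots,n\}^d$ no $r$ distinct points of which lie on a common $k$-dimensional affine subspace of $\mathbb{R}^d$. **Theorem.** Let $d,k,r$ be integers with $0\le k<d$ and $r\ge k+2$. Then $f_{\mathrm{aff}}(n,d,k,r)=\Omega(f_{d,k,r}(n))$ as $n\to\infty$, where $$f_{d,k,r}(n)=\begin{cases} n^{d(1-k/(r-1))}, & \text{if } r\le d,\\ n^{d-k}/(\log n)^{1/d}, & \text{if } r=d+1,\\ n^{d-k}, & \text{if } r>d+1.\end{cases}$$ In particular, for $r=k+2$ we have $f_{\mathrm{aff}}(n,d,k,k+2)=\Omega(f_{d,k}(n))$ as $n\to\infty$, where $$f_{d,k}(n)=\begin{cases} n/(\log n)^{1/d}, & \text{if } k=d-1,\\ n^{d/(k+1)}, & \text{otherwise.}\end{cases}$$ Here $g(n)=\Omega(h(n))$ means that there are a constant $c>0$ and an integer $n_0$, depending only on $d,k,r$, such that $g(n)\ge c\,h(n)$ for all $n\ge n_0$. -/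

import Mathlib

open Filter Asymptotics

noncomputable section

/-- The lattice cube `[n]^d`, where `[n] = {1, …, n}`. -/
def latticeCube (n d : ℕ) : Finset (Fin d → ℕ) :=
  Fintype.piFinset fun _ => Finset.Icc 1 n

/-- A lattice point, viewed as a point of real affine `d`-space. -/
def toRealPoint {d : ℕ} (x : Fin d → ℕ) : Fin d → ℝ := fun i => (x i : ℝ)

/-- No `r` (distinct) points of `S` lie on a common `k`-dimensional affine subspace of `ℝ^d`. -/
def NoPointsOnFlat {d : ℕ} (k r : ℕ) (S : Finset (Fin d → ℕ)) : Prop :=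
  ∀ T : Finset (Fin d → ℕ), T ⊆ S → T.card = r →
    ¬ ∃ A : AffineSubspace ℝ (Fin d → ℝ),
      (A : Set (Fin d → ℝ)).Nonempty ∧ Module.finrank ℝ A.direction = k ∧
        ∀ x ∈ T, toRealPoint x ∈ A

open Classical in
/-- The maximum size of a subset of `[n]^d` with no `r` points on a `k`-dimensional affine
subspace. -/
def fAff (n d k r : ℕ) : ℕ :=
  ((latticeCube n d).powerset.filter fun S => NoPointsOnFlat k r S).sup Finset.card

/-- The lower-bound rate for general `r`. -/
def affRate (d k r n : ℕ) : ℝ :=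
  if r ≤ d then (n : ℝ) ^ ((d : ℝ) * (1 - (k : ℝ) / ((r : ℝ) - 1)))
  else if r = d + 1 then (n : ℝ) ^ ((d : ℝ) - (k : ℝ)) / (Real.log n) ^ (1 / (d : ℝ))
  else (n : ℝ) ^ ((d : ℝ) - (k : ℝ))

/-- The lower-bound rate for `r = k + 2` (here `k + 1 = d` says `k = d - 1`). -/
def affRateDegenerate (d k n : ℕ) : ℝ :=
  if k + 1 = d then (n : ℝ) / (Real.log n) ^ (1 / (d : ℝ))
  else (n : ℝ) ^ ((d : ℝ) / ((k : ℝ) + 1))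

end

/-! The lower bounds come from the deletion method. Keep each point of `[n]^d` independently with
probability `p`; if `M` is the number of `r`-subsets lying on a `k`-flat, then deleting one point
from each surviving such subset leaves at least `p n^d - p^r M` points on average
(`exists_subset_avoiding`). Translating one point of a flat `r`-subset to the origin bounds `M` by
`n^d` times the number of `m`-tuples, `m = r - 1`, of integer vectors of sup norm at most `n` that
span a space of dimension at most `k` (`card_flatSubsets_le`). So everything rests on the sharp
upper bound for the number of integer `d × m` matrices of rank at most `k` with entries bounded by
`n`: it is `O(n^{kd})` if `m < d`, `O(n^{kd} log n)` if `m = d`, and `O(n^{km})` if `m > d`.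

For the matrix count, group the tuples by their span `V`, of dimension `j`; each `V` contributes
at most `N_V^m`, where `N_V` counts the integer points of `V` of norm at most `n`. Choose
independent integer vectors `b_1, …, b_j` in `V` greedily, each of norm at most twice the least
possible one outside the span of its predecessors (`IsGreedy`). A packing argument, repeated along
the flag spanned by the `b_i`, gives `N_V ≤ C n^j / ∏ ‖b_i‖` (`IsGreedy.card_le`), the upper half
of Minkowski's second theorem. Summing `∏ ‖b_i‖^{-m}` over all sequences `(b_i)` instead of over
all `V` already suffices for `m ≠ d`, but for `m = d` it would give `(log n)^j`. What saves the
extra logarithms is that `V` has many greedy sequences: `b_i` may be modified by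
multiples `c b_{i-1}` with `0 ≤ c ≤ ‖b_i‖ / ‖b_{i-1}‖`. Hence the greedy sequences of `V` have total
weight at least `2^{-j}` when a sequence is weighted by `∏ ‖b_{i-1}‖ / ‖b_i‖`
(`SpannedByCube.le_sum_ratioProd`), and with these weights the sums over `b_2, …, b_j` in the case
`m = d` are bounded, so that only the sum over `b_1` produces a logarithm
(`sum_inv_pow_mul_headRatio_le`). -/

/-! ### Packing in subspaces, and greedy sequences of integer vectors -/

open Module MeasureTheory Metric Finset in
/-- The volume bound for packings: the balls of radius `δ / 2` about the points of `s` are disjoint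
and lie in the ball of radius `t + δ / 2`. -/
theorem card_le_of_norm_sub_ge {F : Type*} [NormedAddCommGroup F] [NormedSpace ℝ F]
    [FiniteDimensional ℝ F] (s : Finset F) {t δ : ℝ} (ht : 0 ≤ t) (hδ : 0 < δ)
    (hs : ∀ c ∈ s, ‖c‖ ≤ t) (h : ∀ c ∈ s, ∀ e ∈ s, c ≠ e → δ ≤ ‖c - e‖) :
    (s.card : ℝ) ≤ (1 + 2 * t / δ) ^ finrank ℝ F := by
  borelize F
  let μ : Measure F := Measure.addHaar
  have hδ2 : 0 < δ / 2 := by positivity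
  have hρ : 0 < t + δ / 2 := by positivity
  have D : Set.Pairwise (s : Set F) (Function.onFun Disjoint fun c => ball (c : F) (δ / 2)) := by
    intro c hc e he hce
    apply ball_disjoint_ball
    rw [dist_eq_norm]
    linarith [h c hc e he hce]
  have hsub : (⋃ c ∈ s, ball (c : F) (δ / 2)) ⊆ ball (0 : F) (t + δ / 2) := by
    refine Set.iUnion₂_subset fun x hx => ball_subset_ball' ?_
    rw [dist_zero_right]
    linarith [hs x hx]
  have I : (s.card : ENNReal) * ENNReal.ofReal ((δ / 2) ^ finrank ℝ F) * μ (ball 0 1) ≤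
      ENNReal.ofReal ((t + δ / 2) ^ finrank ℝ F) * μ (ball 0 1) := by
    rw [← μ.addHaar_ball_of_pos 0 hρ]
    refine le_trans (le_of_eq ?_) (measure_mono hsub)
    rw [measure_biUnion_finset D fun c _ => measurableSet_ball]
    simp only [μ.addHaar_ball_of_pos _ hδ2, Finset.sum_const, nsmul_eq_mul, mul_assoc]
  have J := (ENNReal.mul_le_mul_iff_left (measure_ball_pos μ (0 : F) zero_lt_one).ne'
    measure_ball_lt_top.ne).1 I
  have K := ENNReal.toReal_le_of_le_ofReal (pow_nonneg hρ.le _) J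
  rw [ENNReal.toReal_mul, ENNReal.toReal_natCast, ENNReal.toReal_ofReal (by positivity)] at K
  rw [← le_div_iff₀ (by positivity), ← div_pow] at K
  have e : 1 + 2 * t / δ = (t + δ / 2) / (δ / 2) := by
    have := hδ.ne'
    field_simp
    ring
  rwa [e]

variable {d : ℕ}

/-- An integer vector, viewed as a vector of real `d`-space. -/
def intVec (x : Fin d → ℤ) : Fin d → ℝ := fun i => (x i : ℝ)

theorem norm_intVec (x : Fin d → ℤ) : ‖intVec x‖ = ‖x‖ := by
  simp [intVec, Pi.norm_def]
  rfl

theorem intVec_sub (x y : Fin d → ℤ) : intVec (x - y) = intVec x - intVec y := by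
  ext i; simp [intVec]

theorem intVec_add (x y : Fin d → ℤ) : intVec (x + y) = intVec x + intVec y := by
  ext i; simp [intVec]

theorem intVec_nsmul (c : ℕ) (x : Fin d → ℤ) : intVec (c • x) = c • intVec x := by
  ext i; simp [intVec]

theorem intVec_zero : intVec (0 : Fin d → ℤ) = 0 := by
  ext i; simp [intVec]

theorem intVec_injective : Function.Injective (intVec : (Fin d → ℤ) → Fin d → ℝ) := by
  intro x y h
  ext i
  simpa [intVec] using congrFun h i

theorem card_le_of_mem_submodule (W : Submodule ℝ (Fin d → ℝ)) {i : ℕ}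
    (hW : Module.finrank ℝ W ≤ i) (S : Finset (Fin d → ℤ)) {t δ : ℝ} (ht : 0 ≤ t) (hδ : 0 < δ)
    (hS : ∀ x ∈ S, intVec x ∈ W ∧ ‖x‖ ≤ t)
    (hsep : ∀ x ∈ S, ∀ y ∈ S, x ≠ y → δ ≤ ‖x - y‖) :
    (S.card : ℝ) ≤ (1 + 2 * t / δ) ^ i := by
  classical
  let f : {x // x ∈ S} → W := fun x => ⟨intVec x.1, (hS x.1 x.2).1⟩
  have hf : Function.Injective f := fun x y h =>
    Subtype.ext (intVec_injective (congrArg Subtype.val h))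
  have hcard : (S.attach.image f).card = S.card := by
    rw [Finset.card_image_of_injective _ hf, Finset.card_attach]
  have key := card_le_of_norm_sub_ge (S.attach.image f) ht hδ ?_ ?_
  · rw [hcard] at key
    refine key.trans (pow_le_pow_right₀ ?_ hW)
    have : 0 ≤ 2 * t / δ := by positivity
    linarith
  · intro c hc
    obtain ⟨x, -, rfl⟩ := Finset.mem_image.1 hc
    change ‖intVec x.1‖ ≤ t
    rw [norm_intVec]
    exact (hS x.1 x.2).2
  · intro c hc e he hce
    obtain ⟨x, -, rfl⟩ := Finset.mem_image.1 hc
    obtain ⟨y, -, rfl⟩ := Finset.mem_image.1 he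
    change δ ≤ ‖intVec x.1 - intVec y.1‖
    rw [← intVec_sub, norm_intVec]
    exact hsep _ x.2 _ y.2 fun h => hce (by rw [Subtype.ext h])

/-- The real span of a list of integer vectors, by recursion on the list. -/
def spanList : List (Fin d → ℤ) → Submodule ℝ (Fin d → ℝ)
  | [] => ⊥
  | x :: l => spanList l ⊔ Submodule.span ℝ {intVec x}

theorem finrank_spanList_le (l : List (Fin d → ℤ)) :
    Module.finrank ℝ (spanList l) ≤ l.length := by
  induction l with
  | nil => exact (finrank_bot ℝ (Fin d → ℝ)).le
  | cons x l ih =>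
    refine (Submodule.finrank_add_le_finrank_add_finrank _ _).trans ?_
    have : Module.finrank ℝ (Submodule.span ℝ {intVec x}) ≤ 1 := by
      simpa using finrank_span_le_card (R := ℝ) ({intVec x} : Set (Fin d → ℝ))
    simp only [List.length_cons]
    omega

/-- The list `l` consists of integer vectors of `V`, each lying outside the span of those added
before it and having norm at most twice that of any other such choice. The head of the list is the
vector added last. The factor `2` leaves room for many greedy lists in the same `V`. -/
def IsGreedy (V : Submodule ℝ (Fin d → ℝ)) : List (Fin d → ℤ) → Prop
  | [] => True
  | x :: l => IsGreedy V l ∧ intVec x ∈ V ∧ intVec x ∉ spanList l ∧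
      ∀ z : Fin d → ℤ, intVec z ∈ V → intVec z ∉ spanList l → ‖x‖ ≤ 2 * ‖z‖

theorem IsGreedy.spanList_le {V : Submodule ℝ (Fin d → ℝ)} {l : List (Fin d → ℤ)}
    (h : IsGreedy V l) : spanList l ≤ V := by
  induction l with
  | nil => simp [spanList]
  | cons x l ih =>
    refine sup_le (ih h.1) ?_
    rw [Submodule.span_singleton_le_iff_mem]
    exact h.2.1

theorem IsGreedy.length_le_finrank {V : Submodule ℝ (Fin d → ℝ)} {l : List (Fin d → ℤ)}
    (h : IsGreedy V l) : l.length ≤ Module.finrank ℝ (spanList l) := by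
  induction l with
  | nil => simp
  | cons x l ih =>
    have hlt : spanList l < spanList (x :: l) := by
      refine lt_of_le_of_ne le_sup_left fun he => h.2.2.1 ?_
      rw [he]
      exact (le_sup_right : _ ≤ spanList l ⊔ _) (Submodule.mem_span_singleton_self _)
    have := Submodule.finrank_lt_finrank_of_lt hlt
    have := ih h.1
    simp only [List.length_cons]
    omega

theorem IsGreedy.spanList_eq {V : Submodule ℝ (Fin d → ℝ)} {l : List (Fin d → ℤ)}
    (h : IsGreedy V l) (hl : l.length = Module.finrank ℝ V) : spanList l = V :=
  Submodule.eq_of_le_of_finrank_le h.spanList_le (hl ▸ h.length_le_finrank)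

/-- The product of the sup norms of the entries of `l`. -/
def normProd (l : List (Fin d → ℤ)) : ℝ := (l.map fun x => ‖x‖).prod

theorem normProd_cons (x : Fin d → ℤ) (l : List (Fin d → ℤ)) :
    normProd (x :: l) = ‖x‖ * normProd l := by simp [normProd]

theorem IsGreedy.norm_pos {V : Submodule ℝ (Fin d → ℝ)} {x : Fin d → ℤ}
    {l : List (Fin d → ℤ)} (h : IsGreedy V (x :: l)) : 0 < ‖x‖ := by
  rw [norm_pos_iff]
  rintro rfl
  exact h.2.2.1 (by rw [intVec_zero]; exact zero_mem _)

theorem IsGreedy.normProd_pos {V : Submodule ℝ (Fin d → ℝ)} {l : List (Fin d → ℤ)}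
    (h : IsGreedy V l) : 0 < normProd l := by
  induction l with
  | nil => simp [normProd]
  | cons x l ih =>
    rw [normProd_cons]
    exact mul_pos h.norm_pos (ih h.1)

/-- Norms along a greedy list increase up to a factor `2`: a vector `z` that may be added after `y`
was also available when `y` was chosen. -/
theorem IsGreedy.norm_head_le {V : Submodule ℝ (Fin d → ℝ)} {y : Fin d → ℤ}
    {l : List (Fin d → ℤ)} (h : IsGreedy V (y :: l)) {z : Fin d → ℤ} (hz : intVec z ∈ V)
    (hzl : intVec z ∉ spanList (y :: l)) : ‖y‖ ≤ 2 * ‖z‖ :=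
  h.2.2.2 z hz fun h' => hzl ((le_sup_left : spanList l ≤ _) h')

/-- A maximal `δ`-separated subset of `A` is a `δ`-net of `A`. -/
theorem exists_separated_net (A : Finset (Fin d → ℤ)) {δ : ℝ} (hδ : 0 < δ) :
    ∃ S ⊆ A, (∀ x ∈ S, ∀ y ∈ S, x ≠ y → δ ≤ ‖x - y‖) ∧
      ∀ a ∈ A, ∃ s ∈ S, ‖a - s‖ < δ := by
  classical
  obtain ⟨S, hS, hmax⟩ := Finset.exists_max_image
    (A.powerset.filter fun S => ∀ x ∈ S, ∀ y ∈ S, x ≠ y → δ ≤ ‖x - y‖) Finset.card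
    ⟨∅, by simp⟩
  rw [Finset.mem_filter, Finset.mem_powerset] at hS
  refine ⟨S, hS.1, hS.2, fun a ha => ?_⟩
  by_contra! hcon
  have haS : a ∉ S := fun h => by
    have := hcon a h
    simp only [sub_self, norm_zero] at this
    linarith
  have := hmax (insert a S) ?_
  · rw [Finset.card_insert_of_notMem haS] at this
    omega
  · rw [Finset.mem_filter, Finset.mem_powerset]
    refine ⟨Finset.insert_subset ha hS.1, fun x hx y hy hxy => ?_⟩
    rw [Finset.mem_insert] at hx hy
    rcases hx with rfl | hx <;> rcases hy with rfl | hy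
    · exact absurd rfl hxy
    · exact hcon y hy
    · rw [norm_sub_rev]; exact hcon x hx
    · exact hS.2 x hx y hy hxy

/-- The number of integer points of norm at most `t` in the span of a greedy list. To pass from `l`
to `x :: l`, cover the points by `O(t / ‖x‖) ^ (l.length + 1)` sets of radius less than `‖x‖ / 2`,
each of which lies in a translate of the span of `l`. -/
theorem IsGreedy.card_le {V : Submodule ℝ (Fin d → ℝ)} {l : List (Fin d → ℤ)}
    (h : IsGreedy V l) {t : ℝ} (ht : 0 < t) (hlt : ∀ y ∈ l.head?, ‖y‖ ≤ 4 * t)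
    (A : Finset (Fin d → ℤ)) (hA : ∀ x ∈ A, intVec x ∈ spanList l ∧ ‖x‖ ≤ t) :
    (A.card : ℝ) ≤ 8 ^ (l.length ^ 2) * t ^ l.length / normProd l := by
  classical
  induction l generalizing t A with
  | nil =>
    have : A.card ≤ 1 := by
      rw [Finset.card_le_one]
      have h0 : ∀ x ∈ A, x = 0 := fun x hx => intVec_injective <| by
        rw [intVec_zero]; simpa [spanList] using (hA x hx).1
      intro a ha b hb
      rw [h0 a ha, h0 b hb]
    simpa [normProd] using this
  | cons x l ih =>
    have hx := h.norm_pos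
    have hP := h.1.normProd_pos
    have hxt : ‖x‖ ≤ 4 * t := hlt x (by simp)
    obtain ⟨S, hSA, hsep, hnet⟩ := exists_separated_net A (half_pos hx)
    have hScard := card_le_of_mem_submodule _ (finrank_spanList_le (x :: l)) S ht.le (half_pos hx)
      (fun z hz => hA z (hSA hz)) hsep
    -- Around each point of the net, differences are too short to leave the span of `l`.
    have hcell : ∀ s ∈ S, ((A.filter fun a => ‖a - s‖ < ‖x‖ / 2).card : ℝ) ≤
        8 ^ (l.length ^ 2) * (‖x‖ / 2) ^ l.length / normProd l := by
      intro s hs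
      rw [← Finset.card_image_of_injective (f := fun a => a - s) _ (sub_left_injective)]
      refine ih h.1 (half_pos hx) ?_ _ ?_
      · intro y hy
        cases l with
        | nil => simp at hy
        | cons y' l =>
          obtain rfl : y' = y := by simpa using hy
          have := h.1.norm_head_le h.2.1 h.2.2.1
          linarith
      · intro z hz
        obtain ⟨a, ha, rfl⟩ := Finset.mem_image.1 hz
        rw [Finset.mem_filter] at ha
        have hmem : intVec (a - s) ∈ spanList (x :: l) := by
          rw [intVec_sub]
          exact sub_mem (hA a ha.1).1 (hA s (hSA hs)).1
        refine ⟨?_, ha.2.le⟩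
        by_contra hn
        have := h.2.2.2 _ (h.spanList_le hmem) hn
        linarith [ha.2]
    have hcover : A ⊆ S.biUnion fun s => A.filter fun a => ‖a - s‖ < ‖x‖ / 2 := by
      intro a ha
      obtain ⟨s, hs, has⟩ := hnet a ha
      exact Finset.mem_biUnion.2 ⟨s, hs, Finset.mem_filter.2 ⟨ha, has⟩⟩
    have h1 : (A.card : ℝ) ≤
        S.card * (8 ^ (l.length ^ 2) * (‖x‖ / 2) ^ l.length / normProd l) := by
      have := (Finset.card_le_card hcover).trans Finset.card_biUnion_le
      calc (A.card : ℝ) ≤ ∑ s ∈ S, ((A.filter fun a => ‖a - s‖ < ‖x‖ / 2).card : ℝ) := by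
            exact_mod_cast this
        _ ≤ _ := by
            rw [← nsmul_eq_mul]
            exact Finset.sum_le_card_nsmul _ _ _ hcell
    have h2 : 1 + 2 * t / (‖x‖ / 2) ≤ 8 * t / ‖x‖ := by
      rw [le_div_iff₀ hx]
      field_simp
      linarith
    have h3 : (S.card : ℝ) ≤ (8 * t / ‖x‖) ^ (l.length + 1) :=
      hScard.trans (pow_le_pow_left₀ (by positivity) h2 _)
    have h4 : (‖x‖ / 2) ^ l.length ≤ ‖x‖ ^ l.length :=
      pow_le_pow_left₀ (by positivity) (by linarith) _
    calc (A.card : ℝ) ≤ (8 * t / ‖x‖) ^ (l.length + 1) *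
          (8 ^ (l.length ^ 2) * ‖x‖ ^ l.length / normProd l) := by
          refine h1.trans ?_
          gcongr
      _ = 8 ^ (l.length ^ 2 + l.length + 1) * t ^ (l.length + 1) / normProd (x :: l) := by
          have := hx.ne'
          rw [normProd_cons, div_pow, mul_pow, pow_succ ‖x‖]
          field_simp
          ring
      _ ≤ _ := by
          have := h.normProd_pos
          rw [List.length_cons]
          gcongr
          · norm_num
          · nlinarith

/-! ### The weighted number of greedy sequences -/

/-- The integer points of sup norm at most `n`. -/
noncomputable def cube (d n : ℕ) : Finset (Fin d → ℤ) :=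
  Fintype.piFinset fun _ => Finset.Icc (-n : ℤ) n

theorem mem_cube {n : ℕ} {x : Fin d → ℤ} : x ∈ cube d n ↔ ‖x‖ ≤ n := by
  rw [pi_norm_le_iff_of_nonneg (Nat.cast_nonneg n)]
  simp only [cube, Fintype.mem_piFinset, Finset.mem_Icc, Int.norm_eq_abs, ← abs_le]
  exact forall_congr' fun i => by norm_cast

/-- The nonzero integer points of sup norm at most `n`. -/
noncomputable def puncturedCube (d n : ℕ) : Finset (Fin d → ℤ) := (cube d n).erase 0

theorem mem_puncturedCube {n : ℕ} {x : Fin d → ℤ} :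
    x ∈ puncturedCube d n ↔ x ≠ 0 ∧ ‖x‖ ≤ n := by
  rw [puncturedCube, Finset.mem_erase, mem_cube]

theorem cons_uncurry_injective {α : Type*} :
    Function.Injective fun p : α × List α => p.1 :: p.2 := fun p q h => by
  obtain ⟨h1, h2⟩ := List.cons.inj h
  exact Prod.ext h1 h2

/-- The lists of length `j` with entries in `X`. -/
def listsOver {α : Type*} (X : Finset α) : ℕ → Finset (List α)
  | 0 => {[]}
  | j + 1 => (X ×ˢ listsOver X j).map ⟨_, cons_uncurry_injective⟩

theorem sum_listsOver_succ {α : Type*} (X : Finset α) (j : ℕ) (f : List α → ℝ) :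
    ∑ l ∈ listsOver X (j + 1), f l = ∑ l ∈ listsOver X j, ∑ x ∈ X, f (x :: l) := by
  rw [listsOver, Finset.sum_map, Finset.sum_product_right]
  rfl

theorem mem_listsOver {α : Type*} {X : Finset α} {j : ℕ} {l : List α} :
    l ∈ listsOver X j ↔ l.length = j ∧ ∀ x ∈ l, x ∈ X := by
  induction j generalizing l with
  | zero =>
    simp only [listsOver, Finset.mem_singleton, List.length_eq_zero_iff]
    exact ⟨fun h => by simp [h], fun h => h.1⟩
  | succ j ih =>
    simp only [listsOver, Finset.mem_map, Finset.mem_product, Prod.exists,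
      Function.Embedding.coeFn_mk, ih]
    constructor
    · rintro ⟨a, b, ⟨ha, hb, hb'⟩, rfl⟩
      exact ⟨by simp [hb], by simpa using ⟨ha, hb'⟩⟩
    · rintro ⟨h1, h2⟩
      cases l with
      | nil => simp at h1
      | cons a b =>
        exact ⟨a, b, ⟨h2 a (by simp), by simpa using h1, fun x hx => h2 x (by simp [hx])⟩, rfl⟩

/-- The weight `‖y‖ / ‖x‖` for adding `x` after the last vector `y`. It is set to `0` when `x` is too
short to follow `y` in a greedy list, and to `1` when `x` comes first. -/
noncomputable def headRatio : List (Fin d → ℤ) → (Fin d → ℤ) → ℝ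
  | [], _ => 1
  | y :: _, x => if ‖y‖ ≤ 2 * ‖x‖ then ‖y‖ / ‖x‖ else 0

theorem headRatio_nonneg (l : List (Fin d → ℤ)) (x : Fin d → ℤ) : 0 ≤ headRatio l x := by
  cases l with
  | nil => simp [headRatio]
  | cons y l =>
    rw [headRatio]
    split_ifs <;> positivity

theorem headRatio_le_two (l : List (Fin d → ℤ)) (x : Fin d → ℤ) : headRatio l x ≤ 2 := by
  cases l with
  | nil => simp [headRatio]
  | cons y l =>
    rw [headRatio]
    split_ifs with h
    · exact div_le_of_le_mul₀ (norm_nonneg _) (by norm_num) h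
    · norm_num

/-- The product of the weights `headRatio` along a list. -/
noncomputable def ratioProd : List (Fin d → ℤ) → ℝ
  | [] => 1
  | x :: l => ratioProd l * headRatio l x

theorem ratioProd_nonneg (l : List (Fin d → ℤ)) : 0 ≤ ratioProd l := by
  induction l with
  | nil => simp [ratioProd]
  | cons x l ih => exact mul_nonneg ih (headRatio_nonneg l x)

/-- `V` is spanned by its integer points in the cube, in the form: they lie in no subspace
that does not contain `V`. -/
def SpannedByCube (n : ℕ) (V : Submodule ℝ (Fin d → ℝ)) : Prop :=
  ∀ W : Submodule ℝ (Fin d → ℝ), ¬ V ≤ W → ∃ x ∈ cube d n, intVec x ∈ V ∧ intVec x ∉ W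

theorem SpannedByCube.exists_shortest {n : ℕ} {V W : Submodule ℝ (Fin d → ℝ)}
    (hV : SpannedByCube n V) (hW : ¬ V ≤ W) :
    ∃ x ∈ cube d n, intVec x ∈ V ∧ intVec x ∉ W ∧
      ∀ z : Fin d → ℤ, intVec z ∈ V → intVec z ∉ W → ‖x‖ ≤ ‖z‖ := by
  classical
  obtain ⟨x₁, hx₁, hx₁V, hx₁W⟩ := hV W hW
  obtain ⟨x, hx, hmin⟩ := Finset.exists_min_image
    ((cube d n).filter fun x => intVec x ∈ V ∧ intVec x ∉ W) (fun x => ‖x‖)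
    ⟨x₁, by simp [hx₁, hx₁V, hx₁W]⟩
  rw [Finset.mem_filter] at hx
  refine ⟨x, hx.1, hx.2.1, hx.2.2, fun z hzV hzW => ?_⟩
  by_cases hz : z ∈ cube d n
  · exact hmin z (by simp [hz, hzV, hzW])
  · rw [mem_cube, not_le] at hz
    exact (mem_cube.1 hx.1).trans hz.le

open Classical in
/-- The ways of prolonging a greedy list have total weight at least `1 / 2`. If `x₀` is a shortest
admissible vector and `y` the last one, the vectors `x₀ + c • y` with `c ≤ ‖x₀‖ / ‖y‖` are all
admissible: there are at least `‖x₀‖ / ‖y‖` of them, each of weight at least `‖y‖ / (2 ‖x₀‖)`. -/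
theorem IsGreedy.half_le_sum_headRatio {n : ℕ} {V : Submodule ℝ (Fin d → ℝ)}
    (hV : SpannedByCube n V) {l : List (Fin d → ℤ)} (h : IsGreedy V l)
    (hl : l.length < Module.finrank ℝ V) :
    1 / 2 ≤ ∑ x ∈ puncturedCube d (2 * n),
      if IsGreedy V (x :: l) then headRatio l x else 0 := by
  have hW : ¬ V ≤ spanList l := fun hle =>
    absurd ((Submodule.finrank_mono hle).trans (finrank_spanList_le l)) (by omega)
  obtain ⟨x₀, hx₀, hx₀V, hx₀W, hmin⟩ := hV.exists_shortest hW
  have hx₀n := mem_cube.1 hx₀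
  have hnonneg : ∀ x ∈ puncturedCube d (2 * n),
      0 ≤ if IsGreedy V (x :: l) then headRatio l x else 0 := by
    intro x _
    split_ifs
    · exact headRatio_nonneg l x
    · exact le_rfl
  have hx₀pos : 0 < ‖x₀‖ := by
    rw [norm_pos_iff]
    rintro rfl
    exact hx₀W (by rw [intVec_zero]; exact zero_mem _)
  cases l with
  | nil =>
    have hgr : IsGreedy V [x₀] :=
      ⟨trivial, hx₀V, hx₀W, fun z hz hz' => by linarith [hmin z hz hz', norm_nonneg z]⟩
    have hmem : x₀ ∈ puncturedCube d (2 * n) :=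
      mem_puncturedCube.2 ⟨norm_pos_iff.1 hx₀pos, by push_cast; linarith⟩
    refine le_trans ?_ (Finset.single_le_sum hnonneg hmem)
    rw [if_pos hgr, headRatio]
    norm_num
  | cons y l =>
    have hy := h.norm_pos
    set q := ⌊‖x₀‖ / ‖y‖⌋₊ with hq
    have hyW : intVec y ∈ spanList (y :: l) :=
      (le_sup_right : _ ≤ spanList l ⊔ _) (Submodule.mem_span_singleton_self _)
    have hcand : ∀ c ∈ Finset.range (q + 1), ‖x₀ + c • y‖ ≤ 2 * ‖x₀‖ ∧
        intVec (x₀ + c • y) ∈ V ∧ intVec (x₀ + c • y) ∉ spanList (y :: l) := by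
      intro c hc
      have hcq : (c : ℝ) ≤ ‖x₀‖ / ‖y‖ :=
        (Nat.cast_le.2 (Nat.lt_succ_iff.1 (Finset.mem_range.1 hc))).trans
          (Nat.floor_le (by positivity))
      rw [le_div_iff₀ hy] at hcq
      have hcy : ‖c • y‖ ≤ c * ‖y‖ := norm_nsmul_le
      refine ⟨(norm_add_le _ _).trans (by linarith), ?_, ?_⟩
      · rw [intVec_add, intVec_nsmul]
        exact add_mem hx₀V (V.smul_of_tower_mem c h.2.1)
      · rw [intVec_add, intVec_nsmul]
        intro hmem
        exact hx₀W ((Submodule.add_mem_iff_left _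
          ((spanList (y :: l)).smul_of_tower_mem c hyW)).1 hmem)
    have hinj : Function.Injective fun c : ℕ => x₀ + c • y := by
      intro a b hab
      have h1 : a • y = b • y := add_left_cancel hab
      have h2 : y ≠ 0 := norm_pos_iff.1 hy
      obtain ⟨i, hi⟩ := Function.ne_iff.1 h2
      have h3 := congrFun h1 i
      simp only [Pi.smul_apply, nsmul_eq_mul] at h3
      exact_mod_cast mul_right_cancel₀ hi h3
    have hsub : (Finset.range (q + 1)).image (fun c : ℕ => x₀ + c • y) ⊆
        puncturedCube d (2 * n) := by
      intro z hz
      obtain ⟨c, hc, rfl⟩ := Finset.mem_image.1 hz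
      obtain ⟨h1, h2, h3⟩ := hcand c hc
      refine mem_puncturedCube.2 ⟨fun h0 => h3 ?_, ?_⟩
      · rw [h0, intVec_zero]; exact zero_mem _
      · push_cast; linarith
    refine le_trans ?_ (Finset.sum_le_sum_of_subset_of_nonneg hsub fun z hz _ => hnonneg z hz)
    rw [Finset.sum_image fun a _ b _ hab => hinj hab]
    have hterm : ∀ c ∈ Finset.range (q + 1), ‖y‖ / (2 * ‖x₀‖) ≤
        if IsGreedy V ((x₀ + c • y) :: y :: l) then headRatio (y :: l) (x₀ + c • y) else 0 := by
      intro c hc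
      obtain ⟨h1, h2, h3⟩ := hcand c hc
      have hgr : IsGreedy V ((x₀ + c • y) :: y :: l) :=
        ⟨h, h2, h3, fun z hz hz' => by linarith [hmin z hz hz']⟩
      rw [if_pos hgr, headRatio, if_pos (h.norm_head_le h2 h3)]
      have := hgr.norm_pos
      gcongr
    refine le_trans ?_ (Finset.card_nsmul_le_sum _ _ _ hterm)
    rw [Finset.card_range, nsmul_eq_mul]
    have hfl : ‖x₀‖ / ‖y‖ ≤ ((q + 1 : ℕ) : ℝ) := by
      push_cast
      exact (Nat.lt_floor_add_one _).le
    calc (1 : ℝ) / 2 = ‖x₀‖ / ‖y‖ * (‖y‖ / (2 * ‖x₀‖)) := by field_simp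
      _ ≤ _ := by gcongr

open Classical in
theorem SpannedByCube.le_sum_ratioProd {n : ℕ} {V : Submodule ℝ (Fin d → ℝ)}
    (hV : SpannedByCube n V) {j : ℕ} (hj : j ≤ Module.finrank ℝ V) :
    (1 / 2 : ℝ) ^ j ≤ ∑ l ∈ listsOver (puncturedCube d (2 * n)) j,
      if IsGreedy V l then ratioProd l else 0 := by
  induction j with
  | zero => simp [listsOver, IsGreedy, ratioProd]
  | succ j ih =>
    rw [sum_listsOver_succ]
    calc (1 / 2 : ℝ) ^ (j + 1) = (1 / 2) ^ j * (1 / 2) := pow_succ _ _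
      _ ≤ (∑ l ∈ listsOver (puncturedCube d (2 * n)) j,
          if IsGreedy V l then ratioProd l else 0) * (1 / 2) :=
        mul_le_mul_of_nonneg_right (ih (by omega)) (by norm_num)
      _ ≤ _ := by
        rw [Finset.sum_mul]
        refine Finset.sum_le_sum fun l hl => ?_
        by_cases h : IsGreedy V l
        · have hlen := (mem_listsOver.1 hl).1
          have := h.half_le_sum_headRatio hV (by omega)
          rw [if_pos h]
          refine (mul_le_mul_of_nonneg_left this (ratioProd_nonneg l)).trans ?_
          rw [Finset.mul_sum]
          refine Finset.sum_le_sum fun x _ => ?_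
          split_ifs
          · rfl
          · simp
        · rw [if_neg h, zero_mul]
          refine Finset.sum_nonneg fun x _ => ?_
          split_ifs
          · exact ratioProd_nonneg _
          · exact le_rfl

/-- If the first entry contributes at most `S` and each later entry, given its predecessors, at most
`K`, then the weighted sum over lists of length `j + 1` is at most `S * K ^ j`. -/
theorem sum_listsOver_le {X : Finset (Fin d → ℤ)} {m : ℕ} {S K : ℝ} (hK0 : 0 ≤ K)
    (hS : ∑ x ∈ X, (‖x‖ ^ m)⁻¹ ≤ S)
    (hK : ∀ l : List (Fin d → ℤ), l ≠ [] → (∀ y ∈ l, y ∈ X) →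
      ∑ x ∈ X, (‖x‖ ^ m)⁻¹ * headRatio l x ≤ K) (j : ℕ) :
    ∑ l ∈ listsOver X (j + 1), ratioProd l * (normProd l ^ m)⁻¹ ≤ S * K ^ j := by
  have hnn : ∀ l : List (Fin d → ℤ), 0 ≤ ratioProd l * (normProd l ^ m)⁻¹ := fun l =>
    mul_nonneg (ratioProd_nonneg l) (inv_nonneg.2 (pow_nonneg
      (List.prod_nonneg (by simp)) _))
  induction j with
  | zero =>
    rw [sum_listsOver_succ]
    simpa [listsOver, ratioProd, headRatio, normProd] using hS
  | succ j ih =>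
    rw [sum_listsOver_succ, pow_succ, ← mul_assoc]
    refine le_trans ?_ (mul_le_mul_of_nonneg_right ih hK0)
    rw [Finset.sum_mul]
    refine Finset.sum_le_sum fun l hl => ?_
    obtain ⟨hlen, hl⟩ := mem_listsOver.1 hl
    have hne : l ≠ [] := by rintro rfl; simp at hlen
    calc ∑ x ∈ X, ratioProd (x :: l) * (normProd (x :: l) ^ m)⁻¹
        = (ratioProd l * (normProd l ^ m)⁻¹) * ∑ x ∈ X, (‖x‖ ^ m)⁻¹ * headRatio l x := by
          rw [Finset.mul_sum]
          refine Finset.sum_congr rfl fun x _ => ?_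
          rw [ratioProd, normProd_cons, mul_pow, mul_inv]
          ring
      _ ≤ _ := mul_le_mul_of_nonneg_left (hK l hne hl) (hnn l)

/-! ### Counting integer matrices of bounded rank -/

theorem cube_mono {a b : ℕ} (h : a ≤ b) : cube d a ⊆ cube d b := fun _ hx =>
  mem_cube.2 ((mem_cube.1 hx).trans (Nat.cast_le.2 h))

theorem card_cube (d n : ℕ) : (cube d n).card = (2 * n + 1) ^ d := by
  simp only [cube, Fintype.card_piFinset, Int.card_Icc, Finset.prod_const, Finset.card_univ,
    Fintype.card_fin]
  congr 1
  omega

theorem norm_eq_of_mem_shell {k : ℕ} {x : Fin d → ℤ} (hx : x ∈ cube d (k + 1) \ cube d k) :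
    ‖x‖ = (k + 1 : ℕ) := by
  rw [Finset.mem_sdiff] at hx
  refine le_antisymm (mem_cube.1 hx.1) ?_
  obtain ⟨j, hj⟩ : ∃ i, x i ∉ Finset.Icc (-k : ℤ) k := by simpa [cube] using hx.2
  have h1 : ((k + 1 : ℕ) : ℤ) ≤ |x j| := by
    by_contra! H
    push_cast at H
    rw [Int.lt_add_one_iff, abs_le, ← Finset.mem_Icc] at H
    exact hj H
  refine le_trans ?_ (norm_le_pi_norm x j)
  rw [Int.norm_eq_abs]
  exact_mod_cast h1

theorem card_shell_le (k : ℕ) :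
    (cube d (k + 1) \ cube d k).card ≤ 2 * d * 3 ^ (d - 1) * (k + 1) ^ (d - 1) := by
  rw [Finset.card_sdiff_of_subset (cube_mono (Nat.le_succ k)), card_cube, card_cube]
  have h1 := abs_pow_sub_pow_le (2 * (k + 1 : ℤ) + 1) (2 * k + 1) d
  have h2 : |2 * (k + 1 : ℤ) + 1| = 2 * k + 3 := by rw [abs_of_nonneg] <;> omega
  have h3 : |2 * (k : ℤ) + 1| = 2 * k + 1 := by rw [abs_of_nonneg]; omega
  rw [h2, h3, max_eq_left (by omega), show (2 * (k + 1 : ℤ) + 1) - (2 * k + 1) = 2 by ring] at h1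
  have h4 : (2 * (k : ℤ) + 3) ^ (d - 1) ≤ (3 * (k + 1)) ^ (d - 1) :=
    pow_le_pow_left₀ (by omega) (by omega) _
  have h5 := (le_abs_self _).trans h1
  have h6 : (|2| : ℤ) * d * (2 * k + 3) ^ (d - 1) ≤ 2 * d * (3 * (k + 1)) ^ (d - 1) := by
    rw [abs_two]
    gcongr
  rw [mul_pow, ← mul_assoc] at h6
  rw [tsub_le_iff_right]
  zify
  linarith

/-- A sum of a radial function over the punctured cube, estimated shell by shell: there are
`O(s ^ (d - 1))` integer points of norm `s`. -/
theorem sum_puncturedCube_le (n : ℕ) (g : ℝ → ℝ) (hg : ∀ s : ℕ, 0 ≤ g s) :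
    ∑ x ∈ puncturedCube d n, g ‖x‖ ≤
      2 * d * 3 ^ (d - 1) * ∑ s ∈ Finset.range n, ((s + 1 : ℕ) : ℝ) ^ (d - 1) * g (s + 1 : ℕ) := by
  have hs0 : cube d 0 = {0} := by
    ext x
    rw [mem_cube, Finset.mem_singleton, Nat.cast_zero, norm_le_zero_iff]
  have h1 : ∑ x ∈ puncturedCube d n, g ‖x‖ = ∑ x ∈ cube d n, if x = 0 then 0 else g ‖x‖ := by
    rw [puncturedCube, ← Finset.filter_ne', Finset.sum_filter]
    refine Finset.sum_congr rfl fun x _ => ?_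
    by_cases h : x = 0 <;> simp [h]
  rw [h1, Finset.sum_eq_sum_range_sdiff (cube d) (fun {a b} h => cube_mono h), hs0,
    Finset.sum_singleton, if_pos rfl, zero_add, Finset.mul_sum]
  refine Finset.sum_le_sum fun k _ => ?_
  have h2 : ∀ x ∈ cube d (k + 1) \ cube d k, (if x = 0 then 0 else g ‖x‖) ≤ g (k + 1 : ℕ) := by
    intro x hx
    split_ifs
    · exact hg _
    · rw [norm_eq_of_mem_shell hx]
  refine (Finset.sum_le_card_nsmul _ _ _ h2).trans ?_
  rw [nsmul_eq_mul, ← mul_assoc]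
  refine mul_le_mul_of_nonneg_right ?_ (hg _)
  exact_mod_cast card_shell_le k

theorem sum_inv_sq_le (s : Finset ℕ) {a : ℝ} (ha : 0 < a) (hs : ∀ i ∈ s, a ≤ i) :
    ∑ i ∈ s, ((i : ℝ) ^ 2)⁻¹ ≤ 2 / a := by
  obtain ⟨N, hN⟩ := s.exists_nat_subset_range
  have hc : 0 < ⌈a⌉₊ := Nat.ceil_pos.2 ha
  have hsub : s ⊆ Finset.Ioo (⌈a⌉₊ - 1) N := by
    intro i hi
    have h1 := Nat.ceil_le.2 (hs i hi)
    have h2 := Finset.mem_range.1 (hN hi)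
    rw [Finset.mem_Ioo]
    omega
  refine (Finset.sum_le_sum_of_subset_of_nonneg hsub fun _ _ _ => by positivity).trans ?_
  refine (sum_Ioo_inv_sq_le _ _).trans ?_
  have h3 : ((⌈a⌉₊ - 1 : ℕ) : ℝ) + 1 = ⌈a⌉₊ := by
    exact_mod_cast Nat.sub_add_cancel hc
  rw [h3]
  gcongr
  exact Nat.le_ceil a

theorem sum_inv_pow_le_of_lt {m : ℕ} (hm : m < d) (n : ℕ) :
    ∑ x ∈ puncturedCube d n, (‖x‖ ^ m)⁻¹ ≤ 2 * d * 3 ^ (d - 1) * (n : ℝ) ^ (d - m) := by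
  refine (sum_puncturedCube_le n (fun t => (t ^ m)⁻¹) fun s => by positivity).trans ?_
  refine mul_le_mul_of_nonneg_left ?_ (by positivity)
  have h : ∀ s ∈ Finset.range n, ((s + 1 : ℕ) : ℝ) ^ (d - 1) * (((s + 1 : ℕ) : ℝ) ^ m)⁻¹ ≤
      (n : ℝ) ^ (d - 1 - m) := by
    intro s hs
    have hpos : (0 : ℝ) < ((s + 1 : ℕ) : ℝ) := by positivity
    rw [← pow_sub₀ _ hpos.ne' (by omega)]
    exact pow_le_pow_left₀ hpos.le (Nat.cast_le.2 (Finset.mem_range.1 hs)) _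
  refine (Finset.sum_le_card_nsmul _ _ _ h).trans ?_
  rw [Finset.card_range, nsmul_eq_mul, ← pow_succ']
  rw [show d - 1 - m + 1 = d - m by omega]

theorem sum_inv_pow_le_log (hd : 0 < d) (n : ℕ) :
    ∑ x ∈ puncturedCube d n, (‖x‖ ^ d)⁻¹ ≤ 2 * d * 3 ^ (d - 1) * (1 + Real.log n) := by
  refine (sum_puncturedCube_le n (fun t => (t ^ d)⁻¹) fun s => by positivity).trans ?_
  refine mul_le_mul_of_nonneg_left ?_ (by positivity)
  refine le_trans (le_of_eq ?_) (harmonic_le_one_add_log n)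
  rw [harmonic]
  push_cast
  refine Finset.sum_congr rfl fun s _ => ?_
  obtain ⟨e, rfl⟩ := Nat.exists_eq_add_of_lt hd
  have hpos : (0 : ℝ) < (s : ℝ) + 1 := by positivity
  simp only [zero_add, Nat.add_sub_cancel]
  rw [pow_succ, mul_inv, ← mul_assoc, mul_inv_cancel₀ (by positivity), one_mul]

theorem sum_inv_pow_le_of_gt {m : ℕ} (hm : d < m) (n : ℕ) :
    ∑ x ∈ puncturedCube d n, (‖x‖ ^ m)⁻¹ ≤ 2 * d * 3 ^ (d - 1) * 2 := by
  refine (sum_puncturedCube_le n (fun t => (t ^ m)⁻¹) fun s => by positivity).trans ?_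
  rcases Nat.eq_zero_or_pos d with rfl | hd
  · simp
  refine mul_le_mul_of_nonneg_left ?_ (by positivity)
  have h := sum_inv_sq_le ((Finset.range n).image Nat.succ) one_pos (by simp)
  rw [Finset.sum_image fun a _ b _ h => Nat.succ_injective h, div_one] at h
  refine le_trans (Finset.sum_le_sum fun s _ => ?_) h
  have h1 : (1 : ℝ) ≤ ((s + 1 : ℕ) : ℝ) := by norm_cast; omega
  have hpos : (0 : ℝ) < ((s + 1 : ℕ) : ℝ) := by positivity
  rw [← div_eq_mul_inv, div_le_iff₀ (by positivity), Nat.succ_eq_add_one, ← div_eq_inv_mul,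
    le_div_iff₀ (by positivity), ← pow_add]
  exact pow_le_pow_right₀ h1 (by omega)

/-- With the weight `‖y‖ / ‖x‖`, the exponent `d` of the borderline case is raised to `d + 1`; the sum
over `‖x‖ ≥ ‖y‖ / 2` is then `O(1 / ‖y‖)`, which cancels the factor `‖y‖`. -/
theorem sum_inv_pow_mul_headRatio_le (hd : 0 < d) (n : ℕ) {y : Fin d → ℤ} (hy : y ≠ 0)
    (l : List (Fin d → ℤ)) :
    ∑ x ∈ puncturedCube d n, (‖x‖ ^ d)⁻¹ * headRatio (y :: l) x ≤
      2 * d * 3 ^ (d - 1) * 4 := by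
  have hy' : 0 < ‖y‖ := norm_pos_iff.2 hy
  refine (sum_puncturedCube_le n
    (fun t => (t ^ d)⁻¹ * if ‖y‖ ≤ 2 * t then ‖y‖ / t else 0) fun s => ?_).trans ?_
  · split_ifs <;> positivity
  refine mul_le_mul_of_nonneg_left ?_ (by positivity)
  have h := sum_inv_sq_le
    (((Finset.range n).image Nat.succ).filter fun i : ℕ => ‖y‖ ≤ 2 * (i : ℝ))
    (half_pos hy') (fun i hi => by linarith [(Finset.mem_filter.1 hi).2])
  rw [Finset.sum_filter, Finset.sum_image fun a _ b _ h => Nat.succ_injective h] at h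
  calc _ ≤ ‖y‖ * (2 / (‖y‖ / 2)) := by
        refine le_trans ?_ (mul_le_mul_of_nonneg_left h hy'.le)
        rw [Finset.mul_sum]
        refine Finset.sum_le_sum fun s _ => ?_
        rw [Nat.succ_eq_add_one]
        have hpos : (0 : ℝ) < ((s + 1 : ℕ) : ℝ) := by positivity
        split_ifs
        · obtain ⟨e, rfl⟩ := Nat.exists_eq_add_of_lt hd
          refine le_of_eq ?_
          simp only [zero_add, Nat.add_sub_cancel]
          field_simp
          exact (pow_succ _ _).symm
        · simp
    _ = 4 := by field_simp; norm_num

/-- The real span of a tuple of integer vectors. -/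
def tupleSpan {m : ℕ} (v : Fin m → Fin d → ℤ) : Submodule ℝ (Fin d → ℝ) :=
  Submodule.span ℝ (Set.range fun i => intVec (v i))

open Classical in
/-- The `m`-tuples of integer vectors of norm at most `n` whose span has dimension `j`, that is, the
integer `d × m` matrices of rank `j` with entries bounded by `n`. -/
noncomputable def rankTuples (d m n j : ℕ) : Finset (Fin m → Fin d → ℤ) :=
  (Fintype.piFinset fun _ => cube d n).filter fun v => Module.finrank ℝ (tupleSpan v) = j

theorem spannedByCube_tupleSpan {m n : ℕ} {v : Fin m → Fin d → ℤ} (hv : ∀ i, v i ∈ cube d n) :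
    SpannedByCube n (tupleSpan v) := by
  intro W hW
  by_contra! hcon
  refine hW (Submodule.span_le.2 ?_)
  rintro _ ⟨i, rfl⟩
  exact hcon (v i) (hv i) (Submodule.subset_span ⟨i, rfl⟩)

open Classical in
/-- The contribution of a single space `V` to the number of matrices of rank `j = dim V`, bounded by
a weighted sum over its greedy lists, which are among the lists with span `V`. -/
theorem SpannedByCube.card_pow_le {n m : ℕ} (hn : 0 < n) {V : Submodule ℝ (Fin d → ℝ)}
    (hV : SpannedByCube n V) :
    (1 / 2 : ℝ) ^ Module.finrank ℝ V * ((cube d n).filter fun x => intVec x ∈ V).card ^ m ≤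
      (8 ^ (Module.finrank ℝ V ^ 2) * (n : ℝ) ^ Module.finrank ℝ V) ^ m *
        ∑ l ∈ listsOver (puncturedCube d (2 * n)) (Module.finrank ℝ V),
          if spanList l = V then ratioProd l * (normProd l ^ m)⁻¹ else 0 := by
  set j := Module.finrank ℝ V with hj
  set N : ℝ := (((cube d n).filter fun x => intVec x ∈ V).card : ℝ) with hN
  refine (mul_le_mul_of_nonneg_right (hV.le_sum_ratioProd le_rfl) (by positivity)).trans ?_
  rw [Finset.sum_mul, Finset.mul_sum]
  refine Finset.sum_le_sum fun l hl => ?_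
  obtain ⟨hlen, hmem⟩ := mem_listsOver.1 hl
  by_cases h : IsGreedy V l
  · have hspan := h.spanList_eq hlen
    rw [if_pos h, if_pos hspan]
    have hcard : N ≤ 8 ^ (j ^ 2) * (n : ℝ) ^ j / normProd l := by
      rw [← hj] at hlen
      have := h.card_le (t := n) (by positivity) ?_
        ((cube d n).filter fun x => intVec x ∈ V) ?_
      · rwa [hlen] at this
      · intro y hy
        have := (mem_puncturedCube.1 (hmem y (List.mem_of_mem_head? hy))).2
        push_cast at this
        linarith [(Nat.cast_nonneg n : (0 : ℝ) ≤ n)]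
      · intro x hx
        rw [Finset.mem_filter] at hx
        rw [hspan]
        exact ⟨hx.2, mem_cube.1 hx.1⟩
    calc ratioProd l * N ^ m
        ≤ ratioProd l * (8 ^ (j ^ 2) * (n : ℝ) ^ j / normProd l) ^ m :=
          mul_le_mul_of_nonneg_left (pow_le_pow_left₀ (by positivity) hcard _)
            (ratioProd_nonneg l)
      _ = _ := by rw [div_pow]; ring
  · rw [if_neg h, zero_mul]
    split_ifs
    · have := ratioProd_nonneg l
      have : 0 ≤ normProd l := List.prod_nonneg (by simp)
      positivity
    · simp

/-- Summation over all spans: every list has only one span, so it is counted at most once. -/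
theorem card_rankTuples_le (m : ℕ) {n : ℕ} (hn : 0 < n) (j : ℕ) :
    (1 / 2 : ℝ) ^ j * (rankTuples d m n j).card ≤ (8 ^ (j ^ 2) * (n : ℝ) ^ j) ^ m *
      ∑ l ∈ listsOver (puncturedCube d (2 * n)) j, ratioProd l * (normProd l ^ m)⁻¹ := by
  classical
  set B : ℝ := (8 ^ (j ^ 2) * (n : ℝ) ^ j) ^ m with hB
  set L := listsOver (puncturedCube d (2 * n)) j with hL
  set 𝒱 := (rankTuples d m n j).image tupleSpan with h𝒱
  have hfib : ∀ V ∈ 𝒱, (1 / 2 : ℝ) ^ j *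
      ((rankTuples d m n j).filter fun v => tupleSpan v = V).card ≤
      B * ∑ l ∈ L, if spanList l = V then ratioProd l * (normProd l ^ m)⁻¹ else 0 := by
    intro V hV
    obtain ⟨v, hv, rfl⟩ := Finset.mem_image.1 hV
    rw [rankTuples, Finset.mem_filter, Fintype.mem_piFinset] at hv
    have key := (spannedByCube_tupleSpan hv.1).card_pow_le (m := m) hn
    rw [hv.2] at key
    refine le_trans (mul_le_mul_of_nonneg_left ?_ (by positivity)) key
    have hsub : ((rankTuples d m n j).filter fun w => tupleSpan w = tupleSpan v) ⊆
        Fintype.piFinset fun _ : Fin m =>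
          (cube d n).filter fun x => intVec x ∈ tupleSpan v := by
      intro w hw
      rw [Finset.mem_filter, rankTuples, Finset.mem_filter, Fintype.mem_piFinset] at hw
      refine Fintype.mem_piFinset.2 fun i => Finset.mem_filter.2 ⟨hw.1.1 i, ?_⟩
      rw [← hw.2]
      exact Submodule.subset_span ⟨i, rfl⟩
    have := Finset.card_le_card hsub
    rw [Fintype.card_piFinset, Finset.prod_const, Finset.card_univ, Fintype.card_fin] at this
    exact_mod_cast this
  rw [Finset.card_eq_sum_card_image tupleSpan (rankTuples d m n j), Nat.cast_sum, Finset.mul_sum]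
  refine (Finset.sum_le_sum hfib).trans ?_
  rw [← Finset.mul_sum, Finset.sum_comm]
  refine mul_le_mul_of_nonneg_left (Finset.sum_le_sum fun l _ => ?_) (by positivity)
  rw [Finset.sum_ite_eq]
  split_ifs
  · rfl
  · have := ratioProd_nonneg l
    have : 0 ≤ normProd l := List.prod_nonneg (by simp)
    positivity

open Classical in
/-- The `m`-tuples of integer vectors of norm at most `n` whose span has dimension at most `k`. -/
noncomputable def lowRankTuples (d m n k : ℕ) : Finset (Fin m → Fin d → ℤ) :=
  (Fintype.piFinset fun _ => cube d n).filter fun v => Module.finrank ℝ (tupleSpan v) ≤ k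

theorem card_rankTuples_succ_le {m n M : ℕ} (hn : 0 < n) {S K D Λ : ℝ} (hK0 : 0 ≤ K)
    (hS : ∑ x ∈ puncturedCube d (2 * n), (‖x‖ ^ m)⁻¹ ≤ S)
    (hK : ∀ l : List (Fin d → ℤ), l ≠ [] → (∀ y ∈ l, y ∈ puncturedCube d (2 * n)) →
      ∑ x ∈ puncturedCube d (2 * n), (‖x‖ ^ m)⁻¹ * headRatio l x ≤ K)
    (hSD : S * (n : ℝ) ^ m ≤ D * (n : ℝ) ^ M * Λ) (hKD : K * (n : ℝ) ^ m ≤ D * (n : ℝ) ^ M)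
    (i : ℕ) :
    ((rankTuples d m n (i + 1)).card : ℝ) ≤
      2 ^ (i + 1) * 8 ^ ((i + 1) ^ 2 * m) * (D * (n : ℝ) ^ M) ^ (i + 1) * Λ := by
  have h0 : 0 ≤ S := le_trans (Finset.sum_nonneg fun x _ => by positivity) hS
  have h1 := (card_rankTuples_le (d := d) m hn (i + 1)).trans
    (mul_le_mul_of_nonneg_left (sum_listsOver_le hK0 hS hK i) (by positivity))
  have h2 : S * (n : ℝ) ^ m * (K * (n : ℝ) ^ m) ^ i ≤
      (D * (n : ℝ) ^ M * Λ) * (D * (n : ℝ) ^ M) ^ i :=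
    mul_le_mul hSD (pow_le_pow_left₀ (by positivity) hKD _) (by positivity)
      ((by positivity : 0 ≤ S * (n : ℝ) ^ m).trans hSD)
  calc ((rankTuples d m n (i + 1)).card : ℝ)
      = 2 ^ (i + 1) * ((1 / 2) ^ (i + 1) * (rankTuples d m n (i + 1)).card) := by
        rw [← mul_assoc, ← mul_pow]; norm_num
    _ ≤ 2 ^ (i + 1) * ((8 ^ ((i + 1) ^ 2) * (n : ℝ) ^ (i + 1)) ^ m * (S * K ^ i)) := by gcongr
    _ = 2 ^ (i + 1) * 8 ^ ((i + 1) ^ 2 * m) * (S * (n : ℝ) ^ m * (K * (n : ℝ) ^ m) ^ i) := by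
        rw [mul_pow, ← pow_mul, ← pow_mul, mul_pow, ← pow_mul]; ring
    _ ≤ 2 ^ (i + 1) * 8 ^ ((i + 1) ^ 2 * m) *
        ((D * (n : ℝ) ^ M * Λ) * (D * (n : ℝ) ^ M) ^ i) := by gcongr
    _ = _ := by ring

/-- The count of matrices of rank at most `k`, given the bounds `S` and `K` for the first and the
later vectors of a greedy list. The factor `Λ` is the logarithm in the case `m = d`, and `1`
otherwise. -/
theorem card_lowRankTuples_le_of_sums {m n M : ℕ} (hn : 0 < n) {S K D Λ : ℝ} (hK0 : 0 ≤ K)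
    (hD : 1 ≤ D) (hΛ : 1 ≤ Λ)
    (hS : ∑ x ∈ puncturedCube d (2 * n), (‖x‖ ^ m)⁻¹ ≤ S)
    (hK : ∀ l : List (Fin d → ℤ), l ≠ [] → (∀ y ∈ l, y ∈ puncturedCube d (2 * n)) →
      ∑ x ∈ puncturedCube d (2 * n), (‖x‖ ^ m)⁻¹ * headRatio l x ≤ K)
    (hSD : S * (n : ℝ) ^ m ≤ D * (n : ℝ) ^ M * Λ) (hKD : K * (n : ℝ) ^ m ≤ D * (n : ℝ) ^ M)
    (k : ℕ) :
    ((lowRankTuples d m n k).card : ℝ) ≤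
      (k + 1) * (2 ^ k * 8 ^ (k ^ 2 * m) * D ^ k) * ((n : ℝ) ^ (k * M) * Λ) := by
  classical
  have hn1 : (1 : ℝ) ≤ n := by exact_mod_cast hn
  have hDM : 1 ≤ D * (n : ℝ) ^ M := one_le_mul_of_one_le_of_one_le hD (one_le_pow₀ hn1)
  have hj : ∀ j ≤ k, ((rankTuples d m n j).card : ℝ) ≤
      2 ^ k * 8 ^ (k ^ 2 * m) * (D * (n : ℝ) ^ M) ^ k * Λ := by
    intro j hjk
    have h1 : ((rankTuples d m n j).card : ℝ) ≤
        2 ^ j * 8 ^ (j ^ 2 * m) * (D * (n : ℝ) ^ M) ^ j * Λ := by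
      cases j with
      | zero =>
        have := card_rankTuples_le (d := d) m hn 0
        simp [listsOver, ratioProd, normProd] at this
        simp only [pow_zero, mul_one, one_mul, zero_mul, ne_eq, OfNat.ofNat_ne_zero,
          not_false_eq_true, zero_pow]
        refine le_trans ?_ hΛ
        exact_mod_cast this
      | succ i => exact card_rankTuples_succ_le hn hK0 hS hK hSD hKD i
    refine h1.trans ?_
    gcongr
    · norm_num
    · norm_num
  have hsub : lowRankTuples d m n k ⊆
      (Finset.range (k + 1)).biUnion fun j => rankTuples d m n j := by
    intro v hv
    rw [lowRankTuples, Finset.mem_filter] at hv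
    exact Finset.mem_biUnion.2 ⟨_, Finset.mem_range.2 (Nat.lt_succ_of_le hv.2),
      Finset.mem_filter.2 ⟨hv.1, rfl⟩⟩
  have h2 : (lowRankTuples d m n k).card ≤
      ∑ j ∈ Finset.range (k + 1), (rankTuples d m n j).card :=
    (Finset.card_le_card hsub).trans Finset.card_biUnion_le
  calc ((lowRankTuples d m n k).card : ℝ)
      ≤ ∑ j ∈ Finset.range (k + 1), ((rankTuples d m n j).card : ℝ) := by exact_mod_cast h2
    _ ≤ (Finset.range (k + 1)).card •
        (2 ^ k * 8 ^ (k ^ 2 * m) * (D * (n : ℝ) ^ M) ^ k * Λ) :=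
      Finset.sum_le_card_nsmul _ _ _ fun j hj' =>
        hj j (Nat.lt_succ_iff.1 (Finset.mem_range.1 hj'))
    _ = _ := by
      rw [Finset.card_range, nsmul_eq_mul, mul_pow, ← pow_mul, mul_comm M k]
      push_cast
      ring

theorem sum_inv_pow_mul_headRatio_le_two_mul {X : Finset (Fin d → ℤ)} {m : ℕ} {S : ℝ}
    (hS : ∑ x ∈ X, (‖x‖ ^ m)⁻¹ ≤ S) (l : List (Fin d → ℤ)) :
    ∑ x ∈ X, (‖x‖ ^ m)⁻¹ * headRatio l x ≤ 2 * S := by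
  refine le_trans ?_ (mul_le_mul_of_nonneg_left hS zero_le_two)
  rw [Finset.mul_sum]
  refine Finset.sum_le_sum fun x _ => ?_
  rw [mul_comm]
  exact mul_le_mul_of_nonneg_right (headRatio_le_two l x) (by positivity)

theorem exists_card_lowRankTuples_le_of_lt {m : ℕ} (hm : m < d) (k : ℕ) :
    ∃ C : ℝ, 1 ≤ C ∧ ∀ n : ℕ, 0 < n →
      ((lowRankTuples d m n k).card : ℝ) ≤ C * (n : ℝ) ^ (k * d) := by
  set c : ℝ := 2 * d * 3 ^ (d - 1) with hc
  have hc0 : 0 ≤ c := by positivity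
  set D : ℝ := 2 * c * 2 ^ (d - m) + 1 with hD
  have hcD : 0 ≤ c * 2 ^ (d - m) := by positivity
  have hD1 : 1 ≤ D := by rw [hD]; nlinarith
  refine ⟨(k + 1) * (2 ^ k * 8 ^ (k ^ 2 * m) * D ^ k), ?_, fun n hn => ?_⟩
  · have h1 : (1 : ℝ) ≤ k + 1 := by linarith [(Nat.cast_nonneg k : (0 : ℝ) ≤ k)]
    exact one_le_mul_of_one_le_of_one_le h1 (one_le_mul_of_one_le_of_one_le
      (one_le_mul_of_one_le_of_one_le (one_le_pow₀ (by norm_num)) (one_le_pow₀ (by norm_num)))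
      (one_le_pow₀ hD1))
  have hS := sum_inv_pow_le_of_lt hm (2 * n)
  have hnd : (n : ℝ) ^ (d - m) * (n : ℝ) ^ m = (n : ℝ) ^ d := by
    rw [← pow_add, Nat.sub_add_cancel hm.le]
  have hnd0 : (0 : ℝ) ≤ (n : ℝ) ^ d := by positivity
  have hSn : c * ((2 * n : ℕ) : ℝ) ^ (d - m) * (n : ℝ) ^ m = c * 2 ^ (d - m) * (n : ℝ) ^ d := by
    rw [← hnd]; push_cast; ring
  have := card_lowRankTuples_le_of_sums (M := d) (D := D) (Λ := 1) hn (by positivity) hD1 le_rfl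
    hS (fun l _ _ => sum_inv_pow_mul_headRatio_le_two_mul hS l)
    (by rw [hSn]; nlinarith) (by rw [mul_assoc 2, hSn]; nlinarith) k
  rwa [mul_one] at this

theorem exists_card_lowRankTuples_le_of_gt {m : ℕ} (hm : d < m) (k : ℕ) :
    ∃ C : ℝ, 1 ≤ C ∧ ∀ n : ℕ, 0 < n →
      ((lowRankTuples d m n k).card : ℝ) ≤ C * (n : ℝ) ^ (k * m) := by
  set c : ℝ := 2 * d * 3 ^ (d - 1) with hc
  have hc0 : 0 ≤ c := by positivity
  set D : ℝ := 2 * (c * 2) + 1 with hD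
  have hD1 : 1 ≤ D := by rw [hD]; linarith
  refine ⟨(k + 1) * (2 ^ k * 8 ^ (k ^ 2 * m) * D ^ k), ?_, fun n hn => ?_⟩
  · have h1 : (1 : ℝ) ≤ k + 1 := by linarith [(Nat.cast_nonneg k : (0 : ℝ) ≤ k)]
    exact one_le_mul_of_one_le_of_one_le h1 (one_le_mul_of_one_le_of_one_le
      (one_le_mul_of_one_le_of_one_le (one_le_pow₀ (by norm_num)) (one_le_pow₀ (by norm_num)))
      (one_le_pow₀ hD1))
  have hS := sum_inv_pow_le_of_gt hm (2 * n)
  have := card_lowRankTuples_le_of_sums (M := m) (D := D) (Λ := 1) hn (by positivity) hD1 le_rfl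
    hS (fun l _ _ => sum_inv_pow_mul_headRatio_le_two_mul hS l)
    (by rw [mul_one]; gcongr; linarith) (by gcongr; linarith) k
  rwa [mul_one] at this

theorem exists_card_lowRankTuples_le_log (hd : 0 < d) (k : ℕ) :
    ∃ C : ℝ, 1 ≤ C ∧ ∀ n : ℕ, 3 ≤ n →
      ((lowRankTuples d d n k).card : ℝ) ≤ C * ((n : ℝ) ^ (k * d) * Real.log n) := by
  set c : ℝ := 2 * d * 3 ^ (d - 1) with hc
  have hc0 : 0 ≤ c := by positivity
  set D : ℝ := 4 * c + 1 with hD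
  have hD1 : 1 ≤ D := by rw [hD]; linarith
  refine ⟨(k + 1) * (2 ^ k * 8 ^ (k ^ 2 * d) * D ^ k), ?_, fun n hn => ?_⟩
  · have h1 : (1 : ℝ) ≤ k + 1 := by linarith [(Nat.cast_nonneg k : (0 : ℝ) ≤ k)]
    exact one_le_mul_of_one_le_of_one_le h1 (one_le_mul_of_one_le_of_one_le
      (one_le_mul_of_one_le_of_one_le (one_le_pow₀ (by norm_num)) (one_le_pow₀ (by norm_num)))
      (one_le_pow₀ hD1))
  have hn3 : (3 : ℝ) ≤ n := by exact_mod_cast hn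
  have hlog : 1 ≤ Real.log n := by
    rw [Real.le_log_iff_exp_le (by linarith)]
    linarith [Real.exp_one_lt_d9]
  have hlog2 : 1 + Real.log ((2 * n : ℕ) : ℝ) ≤ 3 * Real.log n := by
    push_cast
    rw [Real.log_mul two_ne_zero (by linarith)]
    linarith [Real.log_two_lt_d9]
  have hS := (sum_inv_pow_le_log hd (2 * n)).trans
    (mul_le_mul_of_nonneg_left hlog2 hc0)
  refine card_lowRankTuples_le_of_sums (M := d) (K := c * 4) (D := D) (by omega) (by positivity)
    hD1 hlog hS ?_ ?_ (by gcongr; linarith) k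
  · intro l hl hmem
    cases l with
    | nil => exact absurd rfl hl
    | cons y l =>
      exact sum_inv_pow_mul_headRatio_le hd _ (mem_puncturedCube.1 (hmem y (by simp))).1 l
  · have h1 : c * 3 ≤ D := by linarith
    calc c * (3 * Real.log n) * (n : ℝ) ^ d = (c * 3) * (n : ℝ) ^ d * Real.log n := by ring
      _ ≤ _ := by gcongr

/-! ### The deletion method and the rates -/

/-- A random subset of `P`, to which each point belongs independently with probability `p`, contains
`e` with probability `p ^ e.card`. -/
theorem sum_weight_of_subset {α : Type*} [DecidableEq α] {P e : Finset α} (he : e ⊆ P) (p : ℝ) :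
    ∑ S ∈ P.powerset, (if e ⊆ S then p ^ S.card * (1 - p) ^ (P.card - S.card) else 0) =
      p ^ e.card := by
  have h1 : P.powerset.filter (fun S => e ⊆ S) = (P \ e).powerset.image (e ∪ ·) := by
    rw [← Finset.Icc_eq_image_powerset he]
    ext S
    simp [and_comm]
  have hdisj : ∀ S ∈ (P \ e).powerset, Disjoint e S := fun S hS =>
    Finset.disjoint_of_subset_right (Finset.mem_powerset.1 hS) Finset.disjoint_sdiff
  rw [← Finset.sum_filter, h1, Finset.sum_image]
  · calc _ = ∑ S ∈ (P \ e).powerset,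
          p ^ e.card * (p ^ S.card * (1 - p) ^ ((P \ e).card - S.card)) := by
          refine Finset.sum_congr rfl fun S hS => ?_
          rw [Finset.card_union_of_disjoint (hdisj S hS), Finset.card_sdiff_of_subset he, pow_add,
            Nat.sub_sub, mul_assoc]
      _ = _ := by
          rw [← Finset.mul_sum, Finset.sum_pow_mul_eq_add_pow]
          simp
  · intro S hS T hT h
    have h' : e ∪ S = e ∪ T := h
    rw [← Finset.union_sdiff_cancel_left (hdisj S hS), h',
      Finset.union_sdiff_cancel_left (hdisj T hT)]

/-- The deletion method: some subset `S` of `P` has at least the average value of its size minus the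
number of members of `H` inside it; then one point of each of these is removed. -/
theorem exists_subset_avoiding {α : Type*} [Nonempty α] (P : Finset α) (H : Finset (Finset α)) {r : ℕ}
    (hr : 0 < r) (hH : ∀ e ∈ H, e ⊆ P ∧ e.card = r) {p : ℝ} (hp0 : 0 ≤ p) (hp1 : p ≤ 1) :
    ∃ S ⊆ P, (∀ e ∈ H, ¬ e ⊆ S) ∧ p * P.card - p ^ r * H.card ≤ (S.card : ℝ) := by
  classical
  set w : Finset α → ℝ := fun S => p ^ S.card * (1 - p) ^ (P.card - S.card) with hw
  have hw0 : ∀ S, 0 ≤ w S := fun S =>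
    mul_nonneg (pow_nonneg hp0 _) (pow_nonneg (sub_nonneg.2 hp1) _)
  have hw1 : ∑ S ∈ P.powerset, w S = 1 := by
    rw [hw, Finset.sum_pow_mul_eq_add_pow]; simp
  have hsize : ∑ S ∈ P.powerset, w S * S.card = p * P.card := by
    calc ∑ S ∈ P.powerset, w S * S.card
        = ∑ S ∈ P.powerset, ∑ x ∈ P, if {x} ⊆ S then w S else 0 := by
          refine Finset.sum_congr rfl fun S hS => ?_
          simp only [Finset.singleton_subset_iff]
          rw [← Finset.sum_filter, Finset.filter_mem_eq_inter,
            Finset.inter_eq_right.2 (Finset.mem_powerset.1 hS), Finset.sum_const, nsmul_eq_mul,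
            mul_comm]
      _ = ∑ x ∈ P, p := by
          rw [Finset.sum_comm]
          refine Finset.sum_congr rfl fun x hx => ?_
          rw [sum_weight_of_subset (Finset.singleton_subset_iff.2 hx), Finset.card_singleton, pow_one]
      _ = p * P.card := by rw [Finset.sum_const, nsmul_eq_mul, mul_comm]
  have hedge : ∑ S ∈ P.powerset, w S * (H.filter fun e => e ⊆ S).card = p ^ r * H.card := by
    calc ∑ S ∈ P.powerset, w S * (H.filter fun e => e ⊆ S).card
        = ∑ S ∈ P.powerset, ∑ e ∈ H, if e ⊆ S then w S else 0 := by
          refine Finset.sum_congr rfl fun S _ => ?_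
          rw [← Finset.sum_filter, Finset.sum_const, nsmul_eq_mul, mul_comm]
      _ = ∑ e ∈ H, p ^ r := by
          rw [Finset.sum_comm]
          refine Finset.sum_congr rfl fun e he => ?_
          rw [sum_weight_of_subset (hH e he).1, (hH e he).2]
      _ = p ^ r * H.card := by rw [Finset.sum_const, nsmul_eq_mul, mul_comm]
  -- Some `S` does at least as well as the average.
  obtain ⟨S, hSP, hS⟩ : ∃ S ⊆ P, p * P.card - p ^ r * H.card ≤
      (S.card : ℝ) - (H.filter fun e => e ⊆ S).card := by
    by_contra! hcon
    have hne : ∃ S ∈ P.powerset, 0 < w S := by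
      by_contra! h0
      have := Finset.sum_nonpos h0
      rw [hw1] at this
      linarith
    obtain ⟨S₀, hS₀, hpos⟩ := hne
    have hlt : ∑ S ∈ P.powerset, w S * ((S.card : ℝ) - (H.filter fun e => e ⊆ S).card) <
        ∑ S ∈ P.powerset, w S * (p * P.card - p ^ r * H.card) := by
      refine Finset.sum_lt_sum (fun S hS => mul_le_mul_of_nonneg_left
        (hcon S (Finset.mem_powerset.1 hS)).le (hw0 S)) ⟨S₀, hS₀, ?_⟩
      exact mul_lt_mul_of_pos_left (hcon S₀ (Finset.mem_powerset.1 hS₀)) hpos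
    simp only [mul_sub, Finset.sum_sub_distrib] at hlt
    rw [hsize, hedge, ← Finset.sum_mul, ← Finset.sum_mul, hw1, one_mul, one_mul] at hlt
    exact lt_irrefl _ hlt
  have hne : ∀ e ∈ H, e.Nonempty := fun e he => by
    rw [← Finset.card_pos, (hH e he).2]
    exact hr
  choose! pt hpt using hne
  set B := H.filter fun e => e ⊆ S with hB
  refine ⟨S \ B.image pt, Finset.sdiff_subset.trans hSP, fun e he hsub => ?_, ?_⟩
  · have heB : e ∈ B := Finset.mem_filter.2 ⟨he, hsub.trans Finset.sdiff_subset⟩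
    exact (Finset.mem_sdiff.1 (hsub (hpt e he))).2 (Finset.mem_image_of_mem _ heB)
  · have h1 := Finset.le_card_sdiff (B.image pt) S
    have h2 : (B.image pt).card ≤ B.card := Finset.card_image_le
    have h3 : S.card ≤ (S \ B.image pt).card + B.card := by omega
    have h4 : (S.card : ℝ) ≤ (S \ B.image pt).card + B.card := by exact_mod_cast h3
    linarith

/-- The points of `T` lie on a common `k`-flat. -/
def OnFlat (k : ℕ) (T : Finset (Fin d → ℕ)) : Prop :=
  ∃ A : AffineSubspace ℝ (Fin d → ℝ),
    (A : Set (Fin d → ℝ)).Nonempty ∧ Module.finrank ℝ A.direction = k ∧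
      ∀ x ∈ T, toRealPoint x ∈ A

open Classical in
/-- The `r`-subsets of `[n]^d` that lie on a `k`-flat. -/
noncomputable def flatSubsets (n d k r : ℕ) : Finset (Finset (Fin d → ℕ)) :=
  ((latticeCube n d).powersetCard r).filter (OnFlat k)

theorem card_latticeCube (n d : ℕ) : (latticeCube n d).card = n ^ d := by
  simp [latticeCube]

/-- A flat set of `m + 1` points is determined by one of its points and the differences of the other
points from it, which span a space of dimension at most `k`. -/
theorem card_flatSubsets_le (n d k m : ℕ) :
    (flatSubsets n d k (m + 1)).card ≤ n ^ d * (lowRankTuples d m n k).card := by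
  classical
  set g : (Fin d → ℕ) × (Fin m → Fin d → ℤ) → Finset (Fin d → ℕ) := fun z =>
    insert z.1 (Finset.univ.image fun i a => ((z.1 a : ℤ) + z.2 i a).toNat) with hg
  have hsub : flatSubsets n d k (m + 1) ⊆
      (latticeCube n d ×ˢ lowRankTuples d m n k).image g := by
    intro T hT
    rw [flatSubsets, Finset.mem_filter, Finset.mem_powersetCard] at hT
    obtain ⟨⟨hTn, hcard⟩, A, -, hAk, hTA⟩ := hT
    let E := T.equivFinOfCardEq hcard
    let u : Fin (m + 1) → Fin d → ℕ := fun i => (E.symm i).1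
    have huT : ∀ i, u i ∈ T := fun i => (E.symm i).2
    have hTu : ∀ x ∈ T, ∃ i, u i = x := fun x hx => ⟨E ⟨x, hx⟩, by simp [u]⟩
    have hu : ∀ i a, 1 ≤ u i a ∧ u i a ≤ n := fun i a =>
      Finset.mem_Icc.1 (Fintype.mem_piFinset.1 (hTn (huT i)) a)
    refine Finset.mem_image.2 ⟨(u 0, fun i a => (u i.succ a : ℤ) - u 0 a), ?_, ?_⟩
    · refine Finset.mem_product.2 ⟨hTn (huT 0), Finset.mem_filter.2 ⟨?_, ?_⟩⟩
      · refine Fintype.mem_piFinset.2 fun i => Fintype.mem_piFinset.2 fun a => ?_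
        have h1 := hu i.succ a
        have h2 := hu 0 a
        rw [Finset.mem_Icc]
        dsimp only
        omega
      · rw [← hAk]
        refine Submodule.finrank_mono (Submodule.span_le.2 ?_)
        rintro _ ⟨i, rfl⟩
        have := AffineSubspace.vsub_mem_direction (hTA _ (huT i.succ)) (hTA _ (huT 0))
        have hvec : intVec (fun a => (u i.succ a : ℤ) - u 0 a) =
            toRealPoint (u i.succ) -ᵥ toRealPoint (u 0) := by
          ext a
          simp [intVec, toRealPoint]
        change intVec (fun a => (u i.succ a : ℤ) - u 0 a) ∈ A.direction
        rwa [hvec]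
    · ext x
      simp only [hg, Finset.mem_insert, Finset.mem_image, Finset.mem_univ, true_and]
      have hx : ∀ i : Fin m, (fun a => ((u 0 a : ℤ) + ((u i.succ a : ℤ) - u 0 a)).toNat) =
          u i.succ := fun i => by ext a; simp
      simp only [hx]
      constructor
      · rintro (rfl | ⟨i, rfl⟩)
        · exact huT 0
        · exact huT _
      · intro hxT
        obtain ⟨i, rfl⟩ := hTu x hxT
        refine Fin.cases (Or.inl rfl) (fun i => Or.inr ⟨i, rfl⟩) i
  refine (Finset.card_le_card hsub).trans (Finset.card_image_le.trans ?_)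
  rw [Finset.card_product, card_latticeCube]

/-- The deletion method with `p = (2 Q) ^ (-1 / m)`, for which the expected number of deleted points
is at most half the expected size. -/
theorem le_fAff {n k m : ℕ} (hm : 0 < m) {Q : ℝ} (hQ : 1 ≤ Q)
    (h : ((lowRankTuples d m n k).card : ℝ) ≤ Q) :
    (n : ℝ) ^ d * (2 * Q) ^ (-(1 / (m : ℝ))) / 2 ≤ (fAff n d k (m + 1) : ℝ) := by
  classical
  set p : ℝ := (2 * Q) ^ (-(1 / (m : ℝ))) with hp
  have hp0 : 0 ≤ p := by positivity
  have hp1 : p ≤ 1 := Real.rpow_le_one_of_one_le_of_nonpos (by linarith) (by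
    rw [neg_nonpos]; positivity)
  have hpm : p ^ m = (2 * Q)⁻¹ := by
    have hm' : (m : ℝ) ≠ 0 := by exact_mod_cast hm.ne'
    rw [hp, ← Real.rpow_natCast, ← Real.rpow_mul (by linarith), neg_mul, one_div,
      inv_mul_cancel₀ hm', Real.rpow_neg_one]
  obtain ⟨S, hSP, hSH, hScard⟩ := exists_subset_avoiding (latticeCube n d)
    (flatSubsets n d k (m + 1)) m.succ_pos (fun e he =>
      Finset.mem_powersetCard.1 (Finset.mem_filter.1 he).1) hp0 hp1
  have hS : S.card ≤ fAff n d k (m + 1) := by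
    refine Finset.le_sup (f := Finset.card) (Finset.mem_filter.2 ⟨Finset.mem_powerset.2 hSP, ?_⟩)
    intro T hTS hT hA
    exact hSH T (Finset.mem_filter.2
      ⟨Finset.mem_powersetCard.2 ⟨hTS.trans hSP, hT⟩, hA⟩) hTS
  have hflat : ((flatSubsets n d k (m + 1)).card : ℝ) ≤ (n : ℝ) ^ d * Q := by
    have : ((flatSubsets n d k (m + 1)).card : ℝ) ≤
        (n : ℝ) ^ d * (lowRankTuples d m n k).card := by
      exact_mod_cast card_flatSubsets_le n d k m
    exact this.trans (by gcongr)
  calc (n : ℝ) ^ d * p / 2 = p * (n : ℝ) ^ d - p ^ (m + 1) * ((n : ℝ) ^ d * Q) := by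
        rw [pow_succ, hpm]
        have : Q ≠ 0 := by linarith
        field_simp
        ring
    _ ≤ p * (latticeCube n d).card - p ^ (m + 1) * (flatSubsets n d k (m + 1)).card := by
        rw [card_latticeCube]
        push_cast
        gcongr
    _ ≤ S.card := hScard
    _ ≤ _ := by exact_mod_cast hS

theorem isBigO_fAff {k m : ℕ} (hm : 0 < m) {C : ℝ} (hC : 1 ≤ C) {ρ rate : ℕ → ℝ}
    (hρ : ∀ n, 3 ≤ n → 1 ≤ ρ n)
    (hcount : ∀ n, 3 ≤ n → ((lowRankTuples d m n k).card : ℝ) ≤ C * ρ n)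
    (hrate : ∀ n, 3 ≤ n → rate n = (n : ℝ) ^ d * ρ n ^ (-(1 / (m : ℝ)))) :
    rate =O[atTop] fun n : ℕ => (fAff n d k (m + 1) : ℝ) := by
  refine IsBigO.of_bound (2 * (2 * C) ^ (1 / (m : ℝ))) ?_
  filter_upwards [eventually_ge_atTop 3] with n hn
  have hρn := hρ n hn
  have h := le_fAff hm (one_le_mul_of_one_le_of_one_le hC hρn) (hcount n hn)
  have hc : 0 < (2 * C) ^ (1 / (m : ℝ)) := Real.rpow_pos_of_pos (by linarith) _
  rw [← mul_assoc, Real.mul_rpow (by linarith) (by linarith),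
    Real.rpow_neg (by linarith : 0 ≤ 2 * C)] at h
  rw [hrate n hn, Real.norm_of_nonneg (by positivity), Real.norm_of_nonneg (by positivity)]
  calc (n : ℝ) ^ d * ρ n ^ (-(1 / (m : ℝ)))
      = 2 * (2 * C) ^ (1 / (m : ℝ)) * ((n : ℝ) ^ d *
          (((2 * C) ^ (1 / (m : ℝ)))⁻¹ * ρ n ^ (-(1 / (m : ℝ)))) / 2) := by field_simp
    _ ≤ _ := by gcongr

theorem pow_mul_pow_rpow {n : ℕ} (hn : 0 < n) (d e m : ℕ) :
    (n : ℝ) ^ d * ((n : ℝ) ^ e) ^ (-(1 / (m : ℝ))) = (n : ℝ) ^ ((d : ℝ) - e / m) := by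
  have hn' : (0 : ℝ) < n := by exact_mod_cast hn
  rw [← Real.rpow_natCast, ← Real.rpow_natCast, ← Real.rpow_mul hn'.le, ← Real.rpow_add hn']
  congr 1
  ring

theorem affRate_isBigO {k : ℕ} (hk : k < d) {r : ℕ} (hr : k + 2 ≤ r) :
    (fun n : ℕ => affRate d k r n) =O[atTop] (fun n : ℕ => (fAff n d k r : ℝ)) := by
  obtain ⟨m, rfl⟩ : ∃ m, r = m + 1 := ⟨r - 1, by omega⟩
  have hm : 0 < m := by omega
  have hm' : (m : ℝ) ≠ 0 := by exact_mod_cast hm.ne'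
  have one_le_cast : ∀ n : ℕ, 3 ≤ n → (1 : ℝ) ≤ n := fun n hn => by
    exact_mod_cast (by omega : 1 ≤ n)
  rcases lt_trichotomy m d with hmd | rfl | hmd
  · obtain ⟨C, hC, hcount⟩ := exists_card_lowRankTuples_le_of_lt hmd k
    refine isBigO_fAff hm hC (fun n hn => one_le_pow₀ (one_le_cast n hn))
      (fun n hn => hcount n (by omega)) fun n hn => ?_
    rw [affRate, if_pos (by omega), pow_mul_pow_rpow (by omega)]
    congr 1
    push_cast
    rw [add_sub_cancel_right]
    ring
  · obtain ⟨C, hC, hcount⟩ := exists_card_lowRankTuples_le_log hm k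
    have hlog : ∀ n : ℕ, 3 ≤ n → 1 ≤ Real.log n := fun n hn => by
      have hn3 : (3 : ℝ) ≤ n := by exact_mod_cast hn
      rw [Real.le_log_iff_exp_le (by linarith)]
      linarith [Real.exp_one_lt_d9]
    refine isBigO_fAff hm hC (fun n hn => one_le_mul_of_one_le_of_one_le
      (one_le_pow₀ (one_le_cast n hn)) (hlog n hn)) hcount fun n hn => ?_
    have hl := hlog n hn
    rw [affRate, if_neg (by omega), if_pos rfl, Real.mul_rpow (by positivity) (by linarith),
      ← mul_assoc, pow_mul_pow_rpow (by omega), Real.rpow_neg (by linarith), div_eq_mul_inv]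
    congr 2
    push_cast
    field_simp
  · obtain ⟨C, hC, hcount⟩ := exists_card_lowRankTuples_le_of_gt hmd k
    refine isBigO_fAff hm hC (fun n hn => one_le_pow₀ (one_le_cast n hn))
      (fun n hn => hcount n (by omega)) fun n hn => ?_
    rw [affRate, if_neg (by omega), if_neg (by omega), pow_mul_pow_rpow (by omega)]
    congr 1
    push_cast
    field_simp

theorem affRateDegenerate_eq {k : ℕ} (hk : k < d) (n : ℕ) :
    affRateDegenerate d k n = affRate d k (k + 2) n := by
  rw [affRateDegenerate, affRate]
  by_cases h : k + 1 = d
  · subst h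
    rw [if_pos rfl, if_neg (by omega), if_pos rfl]
    congr 1
    push_cast
    rw [add_sub_cancel_left, Real.rpow_one]
  · rw [if_neg h, if_pos (by omega)]
    congr 1
    push_cast
    have : (k : ℝ) + 1 ≠ 0 := by positivity
    rw [show (k : ℝ) + 2 - 1 = k + 1 by ring]
    field_simp
    ring

theorem theorem1p1 (d k : ℕ) (hk : k < d) :
    (∀ r : ℕ, k + 2 ≤ r →
      (fun n : ℕ => affRate d k r n) =O[atTop] (fun n : ℕ => (fAff n d k r : ℝ))) ∧
    (fun n : ℕ => affRateDegenerate d k n) =O[atTop]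
      (fun n : ℕ => (fAff n d k (k + 2) : ℝ)) := by
  refine ⟨fun r hr => affRate_isBigO hk hr, ?_⟩
  simp only [affRateDegenerate_eq hk]
  exact affRate_isBigO hk le_rfl
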